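/- Order $\mathbb{N}^2$ componentwise, and for $\boldsymbol\alpha,\boldsymbol\beta\in\mathbb{N}^2$ let $\min(\boldsymbol\alpha,\boldsymbol\beta)$ be the componentwise minimum. A submonoid $S$ of $(\mathbb{N}^2,+)$ is a good semigroup if (G1) $\min(\boldsymbol\alpha,\boldsymbol\beta)\in S$ for all $\boldsymbol\alpha,\boldsymbol\beta\in S$; (G2) $\boldsymbol\delta+\mathbb{N}^2\subseteq S$ for some $\boldsymbol\delta\in\mathbb{N}^2$; (G3) if $\boldsymbol\alpha\ne\boldsymbol\beta$ belong to $S$ and $\alpha_i=\beta_i$, then there is $\boldsymbol\epsilon\in S$ with $\epsilon_i>\alpha_i$ and $\epsilon_j=\min\{\alpha_j,\beta_j\}$ for the other index $j$. It is local if $\boldsymbol 0$ is its only element with a zero coordinate. Let $S\subseteq\mathbb{N}^2$ be a local good semigroup and $\boldsymbol c=\boldsymbol c(S)$ its conductor, the least $\boldsymbol\delta$ with $\boldsymbol\delta+\mathbb{N}^2\subseteq S$. For $E$ equal to $\mathbb{N}^2$, $S$ or $C(S)=\boldsymbol c+\mathbb{N}^2$, let $d_E(\boldsymbol\alpha,\boldsymbol\beta)$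 be the common length $n$ of all saturated chains $\boldsymbol\alpha=\boldsymbol\alpha^{(0)}<\dots<\boldsymbol\alpha^{(n)}=\boldsymbol\beta$ in $E$, and let $\boldsymbol e(E)$ be the least element of $E$. For $E\supseteq F$ put $d(E\setminus F)=d_E(\boldsymbol e(E),\boldsymbol\alpha)-d_F(\boldsymbol e(F),\boldsymbol\alpha)$, which does not depend on the choice of $\boldsymbol\alpha$ with $\boldsymbol\alpha+\mathbb{N}^2\subseteq F$. The genus of $S$ is $g(S)=d(\mathbb{N}^2\setminus S)$ and its length is $l(S)=d(S\setminus C(S))$. Write $\boldsymbol\alpha\ll\boldsymbol\beta$ if $\alpha_1<\beta_1$ and $\alpha_2<\beta_2$. For a set $A\subseteq\mathbb{N}^2$ that is disjoint from some $\boldsymbol\delta+\mathbb{N}^2$, define $D^{(1)},D^{(2)},\dots$ recursively: $B^{(i)}$ is the set of those $\boldsymbol\alpha\in A\setminus\bigcup_{j<i}D^{(j)}$ for which no $\boldsymbol\beta\in A\setminus\bigcup_{j<i}D^{(j)}$ satisfies $\boldsymbol\alpha\ll\boldsymbol\beta$, and $D^{(i)}$ is the set of those $\boldsymbol\alpha\in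 B^{(i)}$ that are not of the form $\min(\boldsymbol\beta_1,\boldsymbol\beta_2)$ with $\boldsymbol\beta_1,\boldsymbol\beta_2\in B^{(i)}\setminus\{\boldsymbol\alpha\}$. The number of levels $\operatorname{NL}(A)$ is the number $N$ for which $A$ is the disjoint union of the nonempty sets $D^{(1)},\dots,D^{(N)}$. The type of $S$ is $t(S)=\operatorname{NL}(\operatorname{PF}(S))$, where $\operatorname{PF}(S)=\{\boldsymbol\alpha\in\mathbb{N}^2\setminus S \mid \boldsymbol\alpha+(S\setminus\{\boldsymbol 0\})\subseteq S\}$ is the set of pseudo-Frobenius elements. Then $$g(S)\le t(S)\,l(S).$$ -/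

import Mathlib

namespace GoodSemigroup

/-- A good subsemigroup of `ℕ²`: a submonoid of `(ℕ², +)` with the properties (G1), (G2), (G3).
Property (G3) is written once for each of the two coordinates. -/
structure IsGood (S : AddSubmonoid (ℕ × ℕ)) : Prop where
  min_mem : ∀ α ∈ S, ∀ β ∈ S, (min α.1 β.1, min α.2 β.2) ∈ S
  exists_cone : ∃ δ : ℕ × ℕ, ∀ α : ℕ × ℕ, δ + α ∈ S
  exists_of_fst_eq : ∀ α ∈ S, ∀ β ∈ S, α ≠ β → α.1 = β.1 →
    ∃ ε ∈ S, α.1 < ε.1 ∧ min α.2 β.2 ≤ ε.2 ∧ (α.2 ≠ β.2 → ε.2 = min α.2 β.2)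
  exists_of_snd_eq : ∀ α ∈ S, ∀ β ∈ S, α ≠ β → α.2 = β.2 →
    ∃ ε ∈ S, α.2 < ε.2 ∧ min α.1 β.1 ≤ ε.1 ∧ (α.1 ≠ β.1 → ε.1 = min α.1 β.1)

/-- `S` is local: `0` is its only element with a zero coordinate. -/
def IsLocal (S : AddSubmonoid (ℕ × ℕ)) : Prop :=
  ∀ α ∈ S, α.1 = 0 ∨ α.2 = 0 → α = 0

/-! ### Saturated chains and the distance `d(E \ F)` -/

/-- There is a saturated chain of length `n` in `E` from `α` to `β`, that is, a sequence
`α = a₀ < a₁ < ⋯ < aₙ = β` in `E` (for the componentwise order) without elements of `E` strictly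
between two successive terms. -/
def HasSaturatedChain (E : Set (ℕ × ℕ)) (α β : ℕ × ℕ) (n : ℕ) : Prop :=
  ∃ a : ℕ → ℕ × ℕ, a 0 = α ∧ a n = β ∧ (∀ i ≤ n, a i ∈ E) ∧
    ∀ i < n, a i < a (i + 1) ∧ ∀ γ ∈ E, ¬ (a i < γ ∧ γ < a (i + 1))

/-- `d_E(α, β)`, the length of a saturated chain in `E` from `α` to `β`. For the sets `E` in
question all these chains have the same length, so that the infimum is over a singleton. -/
noncomputable def chainDist (E : Set (ℕ × ℕ)) (α β : ℕ × ℕ) : ℕ :=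
  sInf {n | HasSaturatedChain E α β n}

/-- The componentwise minimum `e(E)` of `E`. It belongs to `E` if `E` is nonempty and closed under
componentwise minima, and it is then the least element of `E`. -/
noncomputable def minElement (E : Set (ℕ × ℕ)) : ℕ × ℕ :=
  (sInf (Prod.fst '' E), sInf (Prod.snd '' E))

/-- The conductor `c(E)`: the least `δ` with `δ + ℕ² ⊆ E`. -/
noncomputable def conductor (E : Set (ℕ × ℕ)) : ℕ × ℕ :=
  minElement {δ | ∀ α : ℕ × ℕ, δ + α ∈ E}

/-- The conductor ideal `C(E) = {β ∈ E | β ≥ c(E)}`. -/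
def conductorIdeal (E : Set (ℕ × ℕ)) : Set (ℕ × ℕ) :=
  {β | β ∈ E ∧ conductor E ≤ β}

/-- `d(E \ F) = d_E(e(E), α) - d_F(e(F), α)` for good relative ideals `E ⊇ F`, where `α` is large.
The number does not depend on `α`, as long as `α + ℕ² ⊆ F`; we take the smallest such `α`, the
conductor of `F`. -/
noncomputable def setDist (E F : Set (ℕ × ℕ)) : ℤ :=
  (chainDist E (minElement E) (conductor F) : ℤ) - chainDist F (minElement F) (conductor F)

/-- The genus `g(S) = d(ℕ² \ S)`. -/
noncomputable def genus (S : AddSubmonoid (ℕ × ℕ)) : ℤ :=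
  setDist Set.univ (S : Set (ℕ × ℕ))

/-- The length `l(S) = d(S \ C(S))`. -/
noncomputable def length (S : AddSubmonoid (ℕ × ℕ)) : ℤ :=
  setDist (S : Set (ℕ × ℕ)) (conductorIdeal (S : Set (ℕ × ℕ)))

/-! ### Levels and the type -/

/-- `α ≪ β`: both coordinates of `α` are strictly smaller than those of `β`. -/
def StrictlyBelow (α β : ℕ × ℕ) : Prop := α.1 < β.1 ∧ α.2 < β.2

/-- The elements of `R` that are maximal for the partial order `α = β ∨ α ≪ β`. -/
def maximals (R : Set (ℕ × ℕ)) : Set (ℕ × ℕ) :=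
  {α | α ∈ R ∧ ∀ β ∈ R, ¬ StrictlyBelow α β}

/-- The elements of `B` that are the componentwise minimum of two elements of `B` other than
themselves. -/
def minima (B : Set (ℕ × ℕ)) : Set (ℕ × ℕ) :=
  {α | α ∈ B ∧ ∃ β₁ ∈ B \ {α}, ∃ β₂ ∈ B \ {α}, α = (min β₁.1 β₂.1, min β₁.2 β₂.2)}

/-- The highest level of `R`. -/
def topLevel (R : Set (ℕ × ℕ)) : Set (ℕ × ℕ) :=
  maximals R \ minima (maximals R)

/-- What is left of `A` after its `n` highest levels `D⁽¹⁾, …, D⁽ⁿ⁾` are removed one after the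
other; the next level `D⁽ⁿ⁺¹⁾` is `topLevel (remaining A n)`. -/
def remaining (A : Set (ℕ × ℕ)) : ℕ → Set (ℕ × ℕ)
  | 0 => A
  | n + 1 => remaining A n \ topLevel (remaining A n)

/-- `NL(A)`, the number of levels of `A`: the `N` such that `A` is the disjoint union of its
(nonempty) levels `D⁽¹⁾, …, D⁽ᴺ⁾`. Such an `N` exists whenever `A` misses some `c + ℕ²`. -/
noncomputable def numLevels (A : Set (ℕ × ℕ)) : ℕ :=
  sInf {N | remaining A N = ∅}

/-- The pseudo-Frobenius elements of `S`: the `α ∈ ℕ² \ S` with `α + M ⊆ S`, where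
`M = S \ {0}`. -/
def pseudoFrobenius (S : AddSubmonoid (ℕ × ℕ)) : Set (ℕ × ℕ) :=
  {α | α ∉ S ∧ ∀ μ ∈ S, μ ≠ 0 → α + μ ∈ S}

/-- The type `t(S) = NL(PF(S))`. -/
noncomputable def semigroupType (S : AddSubmonoid (ℕ × ℕ)) : ℕ :=
  numLevels (pseudoFrobenius S)

end GoodSemigroup

/-! Write T(α) for `translators S α`. Along a saturated chain 0 = α₀ < ⋯ < α_l = c in `S`, with l =
l(S), the sets T(αᵢ) grow from `S` to ℕ². In each step the new elements, translated by a suitable γ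
∈ `S`, are pseudo-Frobenius, so they carry at most t(S) levels (`pathHits_translators_le`).

The size of these sets is measured by `pathHits`: the least number of hits along lattice paths of
fixed length but free endpoint. This measure is defined for arbitrary sets, so the T(αᵢ) need not be
good. Adding m levels to a set raises it by at most m if the result is min-closed
(`pathHits_le_add`). For c₁ + c₂ steps from 0 it equals c₁ + c₂ on ℕ² and is at most d_S(0, c) on
`S`. Hence c₁ + c₂ ≤ d_S(0, c) + t(S) l(S), which is the claim because d_ℕ²(0, c) ≤ c₁ + c₂. -/

namespace GoodSemigroup

/-! ### Levels -/

theorem exists_fst_lt_of_not_topLevel {R : Set (ℕ × ℕ)} {x : ℕ × ℕ}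
    (hx : x ∈ R \ topLevel R) : ∃ v ∈ R, x.1 < v.1 ∧ x.2 ≤ v.2 := by
  obtain ⟨hR, hx⟩ := hx
  by_cases hmax : x ∈ maximals R
  · have hmin : x ∈ minima (maximals R) := by
      by_contra h
      exact hx ⟨hmax, h⟩
    obtain ⟨-, u, ⟨hu, hux⟩, v, ⟨hv, hvx⟩, he⟩ := hmin
    simp only [Set.mem_singleton_iff, Prod.ext_iff] at hux hvx he
    rcases lt_or_ge x.1 u.1 with h | h
    · exact ⟨u, hu.1, h, by omega⟩
    -- Here `u` lies in the column of `x`, strictly above it, so `v` must lie in the row of `x`,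
    -- strictly to its right.
    · exact ⟨v, hv.1, by omega, by omega⟩
  · simp only [maximals, Set.mem_ofPred_eq, not_and, not_forall, not_not] at hmax
    obtain ⟨v, hv, h⟩ := hmax hR
    exact ⟨v, hv, h.1, h.2.le⟩

theorem exists_snd_lt_of_not_topLevel {R : Set (ℕ × ℕ)} {x : ℕ × ℕ}
    (hx : x ∈ R \ topLevel R) : ∃ v ∈ R, x.2 < v.2 ∧ x.1 ≤ v.1 := by
  obtain ⟨hR, hx⟩ := hx
  by_cases hmax : x ∈ maximals R
  · have hmin : x ∈ minima (maximals R) := by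
      by_contra h
      exact hx ⟨hmax, h⟩
    obtain ⟨-, u, ⟨hu, hux⟩, v, ⟨hv, hvx⟩, he⟩ := hmin
    simp only [Set.mem_singleton_iff, Prod.ext_iff] at hux hvx he
    rcases lt_or_ge x.2 u.2 with h | h
    · exact ⟨u, hu.1, h, by omega⟩
    · exact ⟨v, hv.1, by omega, by omega⟩
  · simp only [maximals, Set.mem_ofPred_eq, not_and, not_forall, not_not] at hmax
    obtain ⟨v, hv, h⟩ := hmax hR
    exact ⟨v, hv, h.2, h.1.le⟩

/-- Each level put back allows a move that raises a chosen coordinate and does not lower the other.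
The truncated differences count the moves still needed to pass `c`. -/
theorem exists_mem_ge_of_mem_remaining (A : Set (ℕ × ℕ)) (c : ℕ × ℕ) (i : ℕ) :
    ∀ x ∈ remaining A i, (c.1 - x.1) + (c.2 - x.2) ≤ i → ∃ y ∈ A, c ≤ y := by
  induction i with
  | zero => exact fun x hx h => ⟨x, hx, Prod.mk_le_mk.2 ⟨by omega, by omega⟩⟩
  | succ i ih =>
    intro x hx h
    rcases lt_or_ge x.1 c.1 with h1 | h1
    · obtain ⟨v, hv, hv1, hv2⟩ := exists_fst_lt_of_not_topLevel hx
      exact ih v hv (by omega)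
    · obtain ⟨v, hv, hv1, hv2⟩ := exists_snd_lt_of_not_topLevel hx
      exact ih v hv (by omega)

/-- A set that misses a cone has finitely many levels. -/
theorem remaining_numLevels {A : Set (ℕ × ℕ)} {c : ℕ × ℕ} (hA : ∀ y, c ≤ y → y ∉ A) :
    remaining A (numLevels A) = ∅ := by
  refine Nat.sInf_mem (s := {N | remaining A N = ∅}) ⟨c.1 + c.2, ?_⟩
  refine Set.eq_empty_of_forall_notMem fun x hx => ?_
  obtain ⟨y, hy, hcy⟩ := exists_mem_ge_of_mem_remaining A c _ x hx (by omega)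
  exact hA y hcy hy

/-- The number of the level to which `x` belongs. -/
noncomputable def levelIndex (A : Set (ℕ × ℕ)) (x : ℕ × ℕ) : ℕ :=
  sInf {i | x ∉ remaining A i}

theorem levelIndex_le {A : Set (ℕ × ℕ)} {x : ℕ × ℕ} {i : ℕ} (h : x ∉ remaining A i) :
    levelIndex A x ≤ i := Nat.sInf_le h

theorem mem_remaining_of_lt {A : Set (ℕ × ℕ)} {x : ℕ × ℕ} {i : ℕ} (h : i < levelIndex A x) :
    x ∈ remaining A i := by
  by_contra hx
  exact absurd (levelIndex_le hx) (by omega)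

theorem exists_levelIndex_eq {A : Set (ℕ × ℕ)} {N : ℕ} (hN : remaining A N = ∅) {x : ℕ × ℕ}
    (hx : x ∈ A) : ∃ i, levelIndex A x = i + 1 ∧ x ∈ topLevel (remaining A i) := by
  have hmem : x ∉ remaining A (levelIndex A x) :=
    Nat.sInf_mem (s := {i | x ∉ remaining A i}) ⟨N, by simp [hN]⟩
  cases hi : levelIndex A x with
  | zero => rw [hi] at hmem; exact absurd hx hmem
  | succ i =>
    rw [hi] at hmem
    refine ⟨i, rfl, ?_⟩
    by_contra h
    exact hmem ⟨mem_remaining_of_lt (by omega), h⟩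

theorem levelIndex_lt_of_strictlyBelow {A : Set (ℕ × ℕ)} {N : ℕ} (hN : remaining A N = ∅)
    {x y : ℕ × ℕ} (hx : x ∈ A) (hxy : StrictlyBelow x y) :
    levelIndex A y < levelIndex A x := by
  obtain ⟨i, hi, htop⟩ := exists_levelIndex_eq hN hx
  have : y ∉ remaining A i := fun hy => htop.1.2 y hy hxy
  have := levelIndex_le this
  omega

/-- Otherwise `u` and `v` would both remain when `x` is removed. Lying above the maximal element
`x`, they would be maximal too, and `x` would be excluded from its level as their minimum. -/
theorem min_levelIndex_lt {A : Set (ℕ × ℕ)} {N : ℕ} (hN : remaining A N = ∅)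
    {x u v : ℕ × ℕ} (hx : x ∈ A) (hu : u ≠ x) (hv : v ≠ x)
    (he : x = (min u.1 v.1, min u.2 v.2)) :
    min (levelIndex A u) (levelIndex A v) < levelIndex A x := by
  obtain ⟨i, hi, htop⟩ := exists_levelIndex_eq hN hx
  by_contra! hle
  rw [le_min_iff] at hle
  have he' := Prod.ext_iff.1 he
  simp only at he'
  have key : ∀ w ∈ remaining A i, x.1 ≤ w.1 → x.2 ≤ w.2 → w ∈ maximals (remaining A i) :=
    fun w hw h1 h2 => ⟨hw, fun β hβ hlt =>
      htop.1.2 β hβ ⟨lt_of_le_of_lt h1 hlt.1, lt_of_le_of_lt h2 hlt.2⟩⟩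
  exact htop.2 ⟨htop.1, u,
    ⟨key u (mem_remaining_of_lt (by omega)) (by omega) (by omega), hu⟩, v,
    ⟨key v (mem_remaining_of_lt (by omega)) (by omega) (by omega), hv⟩, he⟩

/-! ### Hits of a set along lattice paths -/

/-- `Y` has an element on the vertical ray that starts in `p`. -/
def HitsColumn (Y : Set (ℕ × ℕ)) (p : ℕ × ℕ) : Prop := ∃ y, p.2 ≤ y ∧ (p.1, y) ∈ Y

/-- `Y` has an element on the horizontal ray that starts in `p`. -/
def HitsRow (Y : Set (ℕ × ℕ)) (p : ℕ × ℕ) : Prop := ∃ x, p.1 ≤ x ∧ (x, p.2) ∈ Y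

open Classical in
/-- The least number of hits of `Y` along a lattice path of `n` unit steps that starts in `p`:
a step to the right is a hit if `Y` meets the vertical ray from its origin, and a step upwards is
a hit if `Y` meets the horizontal ray from its origin. -/
noncomputable def pathHits (Y : Set (ℕ × ℕ)) : ℕ → ℕ × ℕ → ℕ
  | 0, _ => 0
  | n + 1, p =>
    min ((if HitsColumn Y p then 1 else 0) + pathHits Y n (p.1 + 1, p.2))
      ((if HitsRow Y p then 1 else 0) + pathHits Y n (p.1, p.2 + 1))

theorem pathHits_swap (Y : Set (ℕ × ℕ)) (n : ℕ) (p : ℕ × ℕ) :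
    pathHits (Prod.swap ⁻¹' Y) n p = pathHits Y n p.swap := by
  induction n generalizing p with
  | zero => rfl
  | succ n ih =>
    rw [pathHits, ih, ih, min_comm]
    rfl

theorem pathHits_succ_le_fst (Y : Set (ℕ × ℕ)) (n : ℕ) (p : ℕ × ℕ) :
    pathHits Y (n + 1) p ≤ 1 + pathHits Y n (p.1 + 1, p.2) := by
  rw [pathHits]; split_ifs <;> omega

theorem pathHits_succ_le_snd (Y : Set (ℕ × ℕ)) (n : ℕ) (p : ℕ × ℕ) :
    pathHits Y (n + 1) p ≤ 1 + pathHits Y n (p.1, p.2 + 1) := by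
  rw [pathHits]; split_ifs <;> omega

theorem pathHits_succ_le_fst_of_not {Y : Set (ℕ × ℕ)} (n : ℕ) {p : ℕ × ℕ}
    (h : ¬ HitsColumn Y p) : pathHits Y (n + 1) p ≤ pathHits Y n (p.1 + 1, p.2) := by
  rw [pathHits, if_neg h]; omega

theorem pathHits_succ_le_snd_of_not {Y : Set (ℕ × ℕ)} (n : ℕ) {p : ℕ × ℕ}
    (h : ¬ HitsRow Y p) : pathHits Y (n + 1) p ≤ pathHits Y n (p.1, p.2 + 1) := by
  rw [pathHits, if_neg h]; omega

/-- Raise a path from `p` by one row up to its first upward step and omit that step, or the last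
step if there is none. Raising the origin of a step to the right creates no hit. -/
theorem pathHits_snd_le (Y : Set (ℕ × ℕ)) (n : ℕ) (p : ℕ × ℕ) :
    pathHits Y n (p.1, p.2 + 1) ≤ pathHits Y (n + 1) p := by
  induction n generalizing p with
  | zero => simp [pathHits]
  | succ n ih =>
    refine le_min ?_ le_add_self
    have hmono : HitsColumn Y (p.1, p.2 + 1) → HitsColumn Y p :=
      fun ⟨y, hy, hmem⟩ => ⟨y, (Nat.le_succ _).trans hy, hmem⟩
    have := ih (p.1 + 1, p.2)
    by_cases h : HitsColumn Y (p.1, p.2 + 1)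
    · rw [if_pos (hmono h)]
      have := pathHits_succ_le_fst Y n (p.1, p.2 + 1)
      simp only at *
      omega
    · have := pathHits_succ_le_fst_of_not n h
      simp only at *
      omega

theorem pathHits_univ (n : ℕ) (p : ℕ × ℕ) : pathHits Set.univ n p = n := by
  induction n generalizing p with
  | zero => rfl
  | succ n ih =>
    have h1 : HitsColumn Set.univ p := ⟨p.2, le_rfl, trivial⟩
    have h2 : HitsRow Set.univ p := ⟨p.1, le_rfl, trivial⟩
    rw [pathHits, if_pos h1, if_pos h2, ih, ih]
    omega

/-- The function `lev` on `A` decreases along `≪`, and the value at a proper componentwise minimum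
exceeds the lesser one of the two values. -/
structure IsLevelFunction (A : Set (ℕ × ℕ)) (lev : ℕ × ℕ → ℕ) : Prop where
  pos : ∀ x ∈ A, 0 < lev x
  lt_of_strictlyBelow : ∀ x ∈ A, ∀ y ∈ A, StrictlyBelow x y → lev y < lev x
  min_lt : ∀ x ∈ A, ∀ u ∈ A, ∀ v ∈ A, x = (u.1, v.2) → u.1 < v.1 → v.2 < u.2 →
    min (lev u) (lev v) < lev x

theorem IsLevelFunction.swap {A : Set (ℕ × ℕ)} {lev : ℕ × ℕ → ℕ} (h : IsLevelFunction A lev) :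
    IsLevelFunction (Prod.swap ⁻¹' A) (lev ∘ Prod.swap) where
  pos x hx := h.pos _ hx
  lt_of_strictlyBelow x hx y hy hxy := h.lt_of_strictlyBelow _ hx _ hy ⟨hxy.2, hxy.1⟩
  min_lt x hx u hu v hv he h1 h2 := by
    rw [min_comm]
    exact h.min_lt _ hx _ hv _ hu (by rw [he]; rfl) h2 h1

/-- `Y` is closed under componentwise minima. -/
def MinClosed (Y : Set (ℕ × ℕ)) : Prop :=
  ∀ α ∈ Y, ∀ β ∈ Y, (min α.1 β.1, min α.2 β.2) ∈ Y

/-- The path for `Y` starts to the right. The path for `Y'` follows it unless that step is a hit for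
`Y'` only. In that case either a free step upwards exists, or a step costing at most 1 leaves only
new elements of level at most `m - 1`. -/
theorem pathHits_succ_le_of_fst {Y Y' : Set (ℕ × ℕ)} {lev : ℕ × ℕ → ℕ} (hmin : MinClosed Y')
    (hlev : IsLevelFunction (Y' \ Y) lev) {n : ℕ}
    (ih : ∀ (p : ℕ × ℕ) (m : ℕ), (∀ x ∈ Y' \ Y, p ≤ x → lev x ≤ m) →
      pathHits Y' n p ≤ pathHits Y n p + m)
    {p : ℕ × ℕ} {m : ℕ} (hm : ∀ x ∈ Y' \ Y, p ≤ x → lev x ≤ m) :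
    pathHits Y' (n + 1) p ≤
      (open Classical in (if HitsColumn Y p then 1 else 0)) + pathHits Y n (p.1 + 1, p.2) + m := by
  have hp1 : p ≤ (p.1 + 1, p.2) := ⟨Nat.le_succ _, le_rfl⟩
  have hp2 : p ≤ (p.1, p.2 + 1) := ⟨le_rfl, Nat.le_succ _⟩
  have ih1 := ih (p.1 + 1, p.2) m fun x hx h => hm x hx (hp1.trans h)
  have ih2 := ih (p.1, p.2 + 1) m fun x hx h => hm x hx (hp2.trans h)
  by_cases hY : HitsColumn Y p
  · rw [if_pos hY]
    have := pathHits_succ_le_fst Y' n p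
    omega
  rw [if_neg hY]
  by_cases hY' : HitsColumn Y' p
  swap
  · have := pathHits_succ_le_fst_of_not n hY'
    omega
  have hnew : ∀ y, p.2 ≤ y → (p.1, y) ∈ Y' → (p.1, y) ∈ Y' \ Y :=
    fun y hy hmem => ⟨hmem, fun h => hY ⟨y, hy, h⟩⟩
  obtain ⟨y, hy, hmem⟩ := hY'
  have hmy := hm _ (hnew y hy hmem) ⟨le_rfl, hy⟩
  have hpos := hlev.pos _ (hnew y hy hmem)
  -- Since `Y` misses the column, starting one step up is no worse for `Y` than starting one step to
  -- the right.
  have hshift : ∀ k, pathHits Y' n (p.1, p.2 + 1) ≤ pathHits Y n (p.1, p.2 + 1) + k →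
      pathHits Y' n (p.1, p.2 + 1) ≤ pathHits Y n (p.1 + 1, p.2) + k := by
    intro k hk
    have h1 := pathHits_snd_le Y n p
    have h2 := pathHits_succ_le_fst_of_not n hY
    omega
  by_cases hA : ∃ u ∈ Y' \ Y, p.1 < u.1 ∧ p.2 < u.2 ∧ m ≤ lev u
  · obtain ⟨u, hu, hu1, hu2, hum⟩ := hA
    -- A hit in the row and one in the column would put `p` itself into `Y'`, with a level above
    -- that of `u`, hence above `m`.
    have hrow : ¬ HitsRow Y' p := by
      rintro ⟨x, hx, hxmem⟩
      have hpmem : (p.1, p.2) ∈ Y' := by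
        have := hmin _ hmem _ hxmem
        rwa [min_eq_left hx, min_eq_right hy] at this
      have hnp := hnew p.2 le_rfl hpmem
      have h1 := hlev.lt_of_strictlyBelow _ hnp u hu ⟨hu1, hu2⟩
      have h2 := hm _ hnp le_rfl
      omega
    have h1 := pathHits_succ_le_snd_of_not n hrow
    have h2 := hshift m ih2
    omega
  push Not at hA
  by_cases hB : ∃ u ∈ Y' \ Y, p.1 < u.1 ∧ p.2 ≤ u.2 ∧ m ≤ lev u
  · obtain ⟨u, hu, hu1, hu2, hum⟩ := hB
    have hu2' : u.2 = p.2 := by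
      by_contra h
      have := hA u hu hu1 (by omega)
      omega
    -- A `v` of level `m` would have to lie in the column of `p`; then `p` is the minimum of `v` and
    -- `u`, and its level exceeds `m`.
    have ih2' := ih (p.1, p.2 + 1) (m - 1) fun v hv h => by
      by_contra! hlt
      have h1 : p.1 ≤ v.1 := h.1
      have h2 : p.2 + 1 ≤ v.2 := h.2
      have hv1 : v.1 = p.1 := by
        by_contra h
        have := hA v hv (by omega) (by omega)
        omega
      have hpmem : (p.1, p.2) ∈ Y' := by
        have := hmin _ hv.1 _ hu.1
        rwa [hv1, hu2', min_eq_left hu1.le, min_eq_right (by omega)] at this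
      have hnp := hnew p.2 le_rfl hpmem
      have h3 := hlev.min_lt _ hnp v hv u hu (by rw [hv1, hu2']) (by omega) (by omega)
      have h4 := hm _ hnp le_rfl
      omega
    have h1 := pathHits_succ_le_snd Y' n p
    have h2 := hshift _ ih2'
    omega
  · push Not at hB
    have ih1' := ih (p.1 + 1, p.2) (m - 1) fun u hu h => by
      have := hB u hu (Nat.lt_of_succ_le h.1) h.2
      omega
    have h1 := pathHits_succ_le_fst Y' n p
    omega

/-- If a min-closed set `Y'` is obtained from `Y` by adding elements of at most `m` levels, then
the least number of hits along a path increases by at most `m`. -/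
theorem pathHits_le_add {Y Y' : Set (ℕ × ℕ)} {lev : ℕ × ℕ → ℕ} (hmin : MinClosed Y')
    (hlev : IsLevelFunction (Y' \ Y) lev) (n : ℕ) (p : ℕ × ℕ) (m : ℕ)
    (hm : ∀ x ∈ Y' \ Y, p ≤ x → lev x ≤ m) :
    pathHits Y' n p ≤ pathHits Y n p + m := by
  induction n generalizing p m with
  | zero => simp [pathHits]
  | succ n ih =>
    have h1 := pathHits_succ_le_of_fst hmin hlev ih hm
    have h2 := pathHits_succ_le_of_fst (Y := Prod.swap ⁻¹' Y) (Y' := Prod.swap ⁻¹' Y')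
      (lev := lev ∘ Prod.swap) (n := n) (p := p.swap) (m := m)
      (fun α hα β hβ => hmin _ hα _ hβ) hlev.swap
      (fun q k hk => by
        rw [pathHits_swap, pathHits_swap]
        exact ih q.swap k fun x hx hq => hk x.swap hx ⟨hq.2, hq.1⟩)
      (fun x hx hp => hm x.swap hx ⟨hp.2, hp.1⟩)
    rw [pathHits_swap, pathHits_swap] at h2
    rw [pathHits.eq_2 Y, ← min_add_add_right]
    exact le_min h1 h2

/-! ### Saturated chains -/

theorem hasSaturatedChain_zero {E : Set (ℕ × ℕ)} {α : ℕ × ℕ} (hα : α ∈ E) :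
    HasSaturatedChain E α α 0 :=
  ⟨fun _ => α, rfl, rfl, fun _ _ => hα, fun i hi => absurd hi (Nat.not_lt_zero i)⟩

theorem hasSaturatedChain_succ {E : Set (ℕ × ℕ)} {α β : ℕ × ℕ} {n : ℕ} :
    HasSaturatedChain E α β (n + 1) ↔ α ∈ E ∧ ∃ γ, α < γ ∧ (∀ δ ∈ E, ¬ (α < δ ∧ δ < γ)) ∧
      HasSaturatedChain E γ β n := by
  constructor
  · rintro ⟨a, rfl, rfl, hmem, hcov⟩
    exact ⟨hmem 0 (Nat.zero_le _), a 1, (hcov 0 n.succ_pos).1, (hcov 0 n.succ_pos).2,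
      fun i => a (i + 1), rfl, rfl, fun i hi => hmem _ (by omega), fun i hi => hcov _ (by omega)⟩
  · rintro ⟨hα, γ, hlt, hγ, a, rfl, rfl, hmem, hcov⟩
    refine ⟨fun i => Nat.casesOn i α a, rfl, rfl, ?_, ?_⟩
    · rintro (_ | i) hi
      exacts [hα, hmem i (by omega)]
    · rintro (_ | i) hi
      exacts [⟨hlt, hγ⟩, hcov i (by omega)]

theorem HasSaturatedChain.left_mem {E : Set (ℕ × ℕ)} {α β : ℕ × ℕ} {n : ℕ}
    (h : HasSaturatedChain E α β n) : α ∈ E := by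
  obtain ⟨a, rfl, -, hmem, -⟩ := h
  exact hmem 0 (Nat.zero_le _)

theorem HasSaturatedChain.le {E : Set (ℕ × ℕ)} {α β : ℕ × ℕ} {n : ℕ}
    (h : HasSaturatedChain E α β n) : α ≤ β := by
  induction n generalizing α with
  | zero =>
    obtain ⟨a, rfl, rfl, -⟩ := h
    exact le_rfl
  | succ n ih =>
    obtain ⟨-, γ, hlt, -, hγ⟩ := hasSaturatedChain_succ.1 h
    exact hlt.le.trans (ih hγ)

theorem fst_add_snd_lt {α β : ℕ × ℕ} (h : α < β) : α.1 + α.2 < β.1 + β.2 := by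
  rcases Prod.lt_iff.1 h with h | h <;> omega

theorem exists_hasSaturatedChain {E : Set (ℕ × ℕ)} {α β : ℕ × ℕ} (hα : α ∈ E) (hβ : β ∈ E)
    (h : α ≤ β) : ∃ n ≤ (β.1 + β.2) - (α.1 + α.2), HasSaturatedChain E α β n := by
  induction hk : (β.1 + β.2) - (α.1 + α.2) using Nat.strong_induction_on generalizing α with
  | _ k ih =>
    rcases h.eq_or_lt with rfl | hlt
    · exact ⟨0, Nat.zero_le _, hasSaturatedChain_zero hα⟩
    -- An element of least coordinate sum in the interval covers `α`.
    have hne : {s | ∃ γ ∈ E, α < γ ∧ γ ≤ β ∧ γ.1 + γ.2 = s}.Nonempty := ⟨_, β, hβ, hlt, le_rfl, rfl⟩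
    obtain ⟨γ, hγ, hαγ, hγβ, hs⟩ := Nat.sInf_mem hne
    have h1 := fst_add_snd_lt hαγ
    have h2 := fst_add_snd_lt hlt
    obtain ⟨n, hn, hch⟩ := ih _ (by omega) hγ hγβ rfl
    refine ⟨n + 1, by omega, hasSaturatedChain_succ.2 ⟨hα, γ, hαγ, fun δ hδ hlt' => ?_, hch⟩⟩
    have h3 := Nat.sInf_le (s := {s | ∃ γ ∈ E, α < γ ∧ γ ≤ β ∧ γ.1 + γ.2 = s})
      ⟨δ, hδ, hlt'.1, hlt'.2.le.trans hγβ, rfl⟩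
    have h4 := fst_add_snd_lt hlt'.2
    omega

theorem chainDist_le {E : Set (ℕ × ℕ)} {α β : ℕ × ℕ} (hα : α ∈ E) (hβ : β ∈ E) (h : α ≤ β) :
    chainDist E α β ≤ (β.1 + β.2) - (α.1 + α.2) := by
  obtain ⟨n, hn, hch⟩ := exists_hasSaturatedChain hα hβ h
  exact (Nat.sInf_le hch).trans hn

theorem hasSaturatedChain_chainDist {E : Set (ℕ × ℕ)} {α β : ℕ × ℕ} (hα : α ∈ E) (hβ : β ∈ E)
    (h : α ≤ β) : HasSaturatedChain E α β (chainDist E α β) := by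
  obtain ⟨n, -, hch⟩ := exists_hasSaturatedChain hα hβ h
  exact Nat.sInf_mem (s := {n | HasSaturatedChain E α β n}) ⟨n, hch⟩

/-- An element of `E` above `α` lies above the successor `β` of `α` in a saturated chain, unless its
minimum with `β` is `α`. -/
theorem le_of_lt_min {E : Set (ℕ × ℕ)} (hmin : MinClosed E) {α β s : ℕ × ℕ} (hβ : β ∈ E)
    (hαβ : α ≤ β) (hcov : ∀ γ ∈ E, ¬ (α < γ ∧ γ < β)) (hs : s ∈ E) (hαs : α ≤ s)
    (hne : (α.1 < s.1 ∧ α.1 < β.1) ∨ (α.2 < s.2 ∧ α.2 < β.2)) : β ≤ s := by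
  by_contra hβs
  have h1 : α.1 ≤ β.1 ∧ α.2 ≤ β.2 := hαβ
  have h2 : α.1 ≤ s.1 ∧ α.2 ≤ s.2 := hαs
  have h3 : ¬ (β.1 ≤ s.1 ∧ β.2 ≤ s.2) := hβs
  refine hcov _ (hmin s hs β hβ) ⟨Prod.lt_iff.2 ?_, Prod.lt_iff.2 ?_⟩
  all_goals simp only
  all_goals omega

/-! ### Hits along a saturated chain -/

theorem pathHits_le_right {Y : Set (ℕ × ℕ)} (n k x y : ℕ)
    (h : ∀ i < k, ¬ HitsColumn Y (x + i, y)) :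
    pathHits Y (n + k) (x, y) ≤ pathHits Y n (x + k, y) := by
  induction k generalizing x with
  | zero => rfl
  | succ k ih =>
    refine (pathHits_succ_le_fst_of_not (n + k) (h 0 k.succ_pos)).trans ?_
    have := ih (x + 1) fun i hi => by
      have := h (i + 1) (by omega)
      rwa [add_comm i, ← add_assoc] at this
    rwa [add_assoc x, add_comm 1] at this

theorem pathHits_le_up {Y : Set (ℕ × ℕ)} (n k x y : ℕ)
    (h : ∀ i < k, ¬ HitsRow Y (x, y + i)) :
    pathHits Y (n + k) (x, y) ≤ pathHits Y n (x, y + k) := by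
  have := pathHits_le_right (Y := Prod.swap ⁻¹' Y) n k y x h
  rwa [pathHits_swap, pathHits_swap] at this

/-- Walk right, then up, from `α` to `β`. Only the first step can be a hit: an element hit later
would lie above `β` by `le_of_lt_min`, although its column or row comes before that of `β`. -/
theorem pathHits_le_one_add {E : Set (ℕ × ℕ)} (hmin : MinClosed E) {α β : ℕ × ℕ} (hβ : β ∈ E)
    (hlt : α < β) (hcov : ∀ γ ∈ E, ¬ (α < γ ∧ γ < β)) (n : ℕ) :
    pathHits E (n + ((β.1 - α.1) + (β.2 - α.2))) α ≤ 1 + pathHits E n β := by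
  obtain ⟨a, a'⟩ := α
  obtain ⟨b, b'⟩ := β
  have key := fun s hs => le_of_lt_min hmin (s := s) hβ hlt.le hcov hs
  have hle : a ≤ b ∧ a' ≤ b' := hlt.le
  have hsum := fst_add_snd_lt hlt
  simp only [Prod.le_def] at *
  rcases hle.1.eq_or_lt with rfl | hab
  · obtain ⟨k, rfl⟩ := Nat.exists_eq_add_of_lt (show a' < b' by omega)
    have h1 := pathHits_succ_le_snd E (n + k) (a, a')
    have h2 := pathHits_le_up (Y := E) n k a (a' + 1) fun i hi ⟨x, hx, hmem⟩ => by
      have := key _ hmem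
      simp only at this hx
      omega
    rw [show n + (a - a + (a' + k + 1 - a')) = n + k + 1 by omega,
      show a' + k + 1 = a' + 1 + k by omega]
    exact h1.trans (by simpa using h2)
  · obtain ⟨k, rfl⟩ := Nat.exists_eq_add_of_lt hab
    obtain ⟨j, rfl⟩ := Nat.exists_eq_add_of_le hle.2
    have h1 := pathHits_succ_le_fst E (n + j + k) (a, a')
    have h2 := pathHits_le_right (Y := E) (n + j) k (a + 1) a' fun i hi ⟨x, hx, hmem⟩ => by
      have := key _ hmem
      simp only at this hx
      omega
    have h3 := pathHits_le_up (Y := E) n j (a + k + 1) a' fun i hi ⟨x, hx, hmem⟩ => by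
      have := key _ hmem
      simp only at this hx
      omega
    rw [show n + (a + k + 1 - a + (a' + j - a')) = n + j + k + 1 by omega]
    rw [show a + 1 + k = a + k + 1 by omega] at h2
    simp only at h1
    omega

theorem HasSaturatedChain.pathHits_le {E : Set (ℕ × ℕ)} (hmin : MinClosed E) {α β : ℕ × ℕ}
    {n : ℕ} (h : HasSaturatedChain E α β n) :
    pathHits E ((β.1 - α.1) + (β.2 - α.2)) α ≤ n := by
  induction n generalizing α with
  | zero =>
    obtain ⟨a, rfl, rfl, -⟩ := h
    simp [pathHits]
  | succ n ih =>
    obtain ⟨-, γ, hlt, hcov, hγ⟩ := hasSaturatedChain_succ.1 h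
    have h1 := pathHits_le_one_add hmin hγ.left_mem hlt hcov ((β.1 - γ.1) + (β.2 - γ.2))
    have h2 := ih hγ
    have h3 : α.1 ≤ γ.1 ∧ α.2 ≤ γ.2 := hlt.le
    have h4 : γ.1 ≤ β.1 ∧ γ.2 ≤ β.2 := hγ.le
    rw [show β.1 - γ.1 + (β.2 - γ.2) + (γ.1 - α.1 + (γ.2 - α.2)) =
      β.1 - α.1 + (β.2 - α.2) by omega] at h1
    omega

/-! ### Good semigroups -/

/-- The image of `S` under the exchange of the two coordinates. -/
def swapSubmonoid (S : AddSubmonoid (ℕ × ℕ)) : AddSubmonoid (ℕ × ℕ) :=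
  S.comap (AddEquiv.prodComm : ℕ × ℕ ≃+ ℕ × ℕ).toAddMonoidHom

theorem IsGood.swap {S : AddSubmonoid (ℕ × ℕ)} (h : IsGood S) : IsGood (swapSubmonoid S) where
  min_mem α hα β hβ := h.min_mem _ hα _ hβ
  exists_cone := by
    obtain ⟨δ, hδ⟩ := h.exists_cone
    exact ⟨δ.swap, fun α => hδ α.swap⟩
  exists_of_fst_eq α hα β hβ hne he := by
    obtain ⟨ε, hε, hh⟩ := h.exists_of_snd_eq _ hα _ hβ (Prod.swap_injective.ne hne) he
    exact ⟨ε.swap, hε, hh⟩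
  exists_of_snd_eq α hα β hβ hne he := by
    obtain ⟨ε, hε, hh⟩ := h.exists_of_fst_eq _ hα _ hβ (Prod.swap_injective.ne hne) he
    exact ⟨ε.swap, hε, hh⟩

theorem IsGood.mem_of_conductor_le {S : AddSubmonoid (ℕ × ℕ)} (h : IsGood S) {x : ℕ × ℕ}
    (hx : conductor (S : Set (ℕ × ℕ)) ≤ x) : x ∈ S := by
  obtain ⟨δ, hδ⟩ := h.exists_cone
  have hne : {δ : ℕ × ℕ | ∀ α : ℕ × ℕ, δ + α ∈ (S : Set (ℕ × ℕ))}.Nonempty := ⟨δ, hδ⟩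
  -- The two coordinates of the conductor may be attained at different cone apexes; `x` is a minimum
  -- of one point from each cone.
  obtain ⟨u, hu, hu1⟩ := Nat.sInf_mem (hne.image Prod.fst)
  obtain ⟨v, hv, hv2⟩ := Nat.sInf_mem (hne.image Prod.snd)
  have hx1 : u.1 ≤ x.1 := hu1.trans_le hx.1
  have hx2 : v.2 ≤ x.2 := hv2.trans_le hx.2
  have h1 : u + (x.1 - u.1, x.2) ∈ S := hu _
  have h2 : v + (x.1, x.2 - v.2) ∈ S := hv _
  have h3 := h.min_mem _ h1 _ h2
  simp only [Prod.fst_add, Prod.snd_add] at h3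
  rwa [show min (u.1 + (x.1 - u.1)) (v.1 + x.1) = x.1 by omega,
    show min (u.2 + x.2) (v.2 + (x.2 - v.2)) = x.2 by omega] at h3

theorem IsGood.row_mem {S : AddSubmonoid (ℕ × ℕ)} (h : IsGood S) {c : ℕ × ℕ}
    (hc : ∀ x, c ≤ x → x ∈ S) {u u' v : ℕ} (hu : c.1 ≤ u) (hmem : (u, v) ∈ S) (hle : u ≤ u') :
    (u', v) ∈ S := by
  have hfar : ∀ n, ∃ w, u + n ≤ w ∧ (w, v) ∈ S := by
    intro n
    induction n with
    | zero => exact ⟨u, le_rfl, hmem⟩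
    | succ n ih =>
      obtain ⟨w, hw, hwmem⟩ := ih
      -- (G3) against a point of the cone in the same column gives an element further right in row
      -- `v`.
      obtain ⟨ε, hε, h1, h2, h3⟩ := h.exists_of_fst_eq _ hwmem (w, v + c.2 + 1)
        (hc _ ⟨by simp only; omega, by simp only; omega⟩) (by simp [Prod.ext_iff]; omega) rfl
      simp only at h1 h2 h3
      refine ⟨ε.1, by omega, ?_⟩
      rwa [show v = ε.2 by omega]
  obtain ⟨w, hw, hwmem⟩ := hfar (u' - u)
  have := h.min_mem _ hwmem _ (hc (u', v + c.2) ⟨by simp only; omega, by simp only; omega⟩)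
  rwa [show min w u' = u' by omega, show min v (v + c.2) = v by omega] at this

/-- The elements of `ℕ²` that translate all elements `s ≥ α` of `S` into `S`. -/
def translators (S : AddSubmonoid (ℕ × ℕ)) (α : ℕ × ℕ) : Set (ℕ × ℕ) :=
  {x | ∀ s ∈ S, α ≤ s → x + s ∈ S}

theorem IsGood.minClosed_translators {S : AddSubmonoid (ℕ × ℕ)} (h : IsGood S) (α : ℕ × ℕ) :
    MinClosed (translators S α) := by
  intro x hx y hy s hs hαs
  have := h.min_mem _ (hx s hs hαs) _ (hy s hs hαs)
  simp only [Prod.fst_add, Prod.snd_add, min_add_add_right] at this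
  exact this

/-- The elements of `S` above `α` but not above `β` lie in the row of `α`. The test element is the
last one in this row, or one at or beyond `c.1` if there is no last one. -/
theorem IsGood.exists_translator_test_row {S : AddSubmonoid (ℕ × ℕ)} (h : IsGood S)
    {α β : ℕ × ℕ} (hα : α ∈ S) (hβ : β ∈ S) (hcov : ∀ γ ∈ S, ¬ (α < γ ∧ γ < β))
    (h1 : α.1 = β.1) (h2 : α.2 < β.2) :
    ∃ γ ∈ S, α ≤ γ ∧ ∀ x ∈ translators S β, x + γ ∈ S → x ∈ translators S α := by
  obtain ⟨c, hc⟩ : ∃ c : ℕ × ℕ, ∀ x, c ≤ x → x ∈ S := ⟨_, fun x => h.mem_of_conductor_le⟩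
  have hαβ : α ≤ β := ⟨h1.le, h2.le⟩
  obtain ⟨u, hu, huS, hmax⟩ : ∃ u, α.1 ≤ u ∧ (u, α.2) ∈ S ∧
      (c.1 ≤ u ∨ ∀ w, α.1 ≤ w → (w, α.2) ∈ S → w ≤ u) := by
    have hne : {u | α.1 ≤ u ∧ (u, α.2) ∈ S}.Nonempty := ⟨α.1, le_rfl, hα⟩
    by_cases hb : BddAbove {u | α.1 ≤ u ∧ (u, α.2) ∈ S}
    · obtain ⟨hu, huS⟩ := Nat.sSup_mem hne hb
      exact ⟨_, hu, huS, Or.inr fun w hw hwS => le_csSup hb ⟨hw, hwS⟩⟩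
    · obtain ⟨u, ⟨hu, huS⟩, hcu⟩ := not_bddAbove_iff.1 hb c.1
      exact ⟨u, hu, huS, Or.inl hcu.le⟩
  refine ⟨(u, α.2), huS, ⟨hu, le_rfl⟩, fun x hx hxu s hs hαs => ?_⟩
  have key := fun s hs => le_of_lt_min h.min_mem (s := s) hβ hαβ hcov hs
  by_cases hβs : β ≤ s
  · exact hx s hs hβs
  have hs1 : α.1 ≤ s.1 := hαs.1
  have hs2 : s.2 = α.2 := by
    by_contra hne
    exact hβs (key s hs hαs (Or.inr ⟨lt_of_le_of_ne hαs.2 (Ne.symm hne), h2⟩))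
  rcases lt_trichotomy s.1 u with hlt | heq | hgt
  · obtain ⟨ε, hε, he2, -, he1⟩ := h.exists_of_snd_eq _ hs _ huS
      (by simp only [ne_eq, Prod.ext_iff]; omega) hs2
    simp only at he1
    have hxε := hx ε hε (key ε hε ⟨by omega, by omega⟩ (Or.inr ⟨by omega, h2⟩))
    have := h.min_mem _ hxu _ hxε
    simp only [Prod.fst_add, Prod.snd_add] at this
    rwa [show min (x.1 + u) (x.1 + ε.1) = x.1 + s.1 by omega,
      show min (x.2 + α.2) (x.2 + ε.2) = x.2 + s.2 by omega] at this
  · rwa [show s = (u, α.2) from Prod.ext heq hs2]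
  · rcases hmax with hcu | hmax
    · have := h.row_mem hc (u' := x.1 + s.1) (le_add_left hcu) hxu (by omega)
      rwa [← hs2] at this
    · have := hmax s.1 hs1 (by rwa [← hs2])
      omega

/-- Between the translators for two successive terms of a saturated chain one can decide with a
single element of `S`. -/
theorem IsGood.exists_translator_test {S : AddSubmonoid (ℕ × ℕ)} (h : IsGood S)
    {α β : ℕ × ℕ} (hα : α ∈ S) (hβ : β ∈ S) (hlt : α < β)
    (hcov : ∀ γ ∈ S, ¬ (α < γ ∧ γ < β)) :
    ∃ γ ∈ S, α ≤ γ ∧ ∀ x ∈ translators S β, x + γ ∈ S → x ∈ translators S α := by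
  have hle : α.1 ≤ β.1 ∧ α.2 ≤ β.2 := hlt.le
  have hsum := fst_add_snd_lt hlt
  rcases hle.1.eq_or_lt with h1 | h1
  · exact h.exists_translator_test_row hα hβ hcov h1 (by omega)
  rcases hle.2.eq_or_lt with h2 | h2
  · obtain ⟨γ, hγ, hle', htest⟩ := h.swap.exists_translator_test_row (α := α.swap) (β := β.swap)
      hα hβ (fun γ hγ hh => hcov γ.swap hγ
        ⟨Prod.swap_lt_swap.1 hh.1, Prod.swap_lt_swap.1 hh.2⟩) h2 h1
    exact ⟨γ.swap, hγ, ⟨hle'.2, hle'.1⟩, fun x hx hxγ s hs hαs =>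
      htest x.swap (fun t ht hβt => hx t.swap ht ⟨hβt.2, hβt.1⟩) hxγ s.swap hs ⟨hαs.2, hαs.1⟩⟩
  -- If both coordinates increase, `α` is the only element of `S` above `α` that is not above `β`.
  · refine ⟨α, hα, le_rfl, fun x hx hxα s hs hαs => ?_⟩
    by_cases hβs : β ≤ s
    · exact hx s hs hβs
    have hs' : α.1 ≤ s.1 ∧ α.2 ≤ s.2 := hαs
    have key : ¬ ((α.1 < s.1 ∧ α.1 < β.1) ∨ (α.2 < s.2 ∧ α.2 < β.2)) := fun hne =>
      hβs (le_of_lt_min h.min_mem hβ hlt.le hcov hs hαs hne)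
    rwa [show s = α from Prod.ext (by omega) (by omega)]

/-! ### Growth of the translators along a saturated chain -/

theorem remaining_semigroupType {S : AddSubmonoid (ℕ × ℕ)} (h : IsGood S) :
    remaining (pseudoFrobenius S) (semigroupType S) = ∅ :=
  remaining_numLevels (c := conductor (S : Set (ℕ × ℕ)))
    fun _ hy hmem => hmem.1 (h.mem_of_conductor_le hy)

theorem pathHits_translators_le {S : AddSubmonoid (ℕ × ℕ)} (h : IsGood S) (hloc : IsLocal S)
    {α β : ℕ × ℕ} (hα : α ∈ S) (hβ : β ∈ S) (hlt : α < β)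
    (hcov : ∀ γ ∈ S, ¬ (α < γ ∧ γ < β)) (n : ℕ) (p : ℕ × ℕ) :
    pathHits (translators S β) n p ≤ pathHits (translators S α) n p + semigroupType S := by
  obtain ⟨γ, hγ, hαγ, htest⟩ := h.exists_translator_test hα hβ hlt hcov
  have hsum := fst_add_snd_lt hlt
  have hle : α.1 ≤ β.1 ∧ α.2 ≤ β.2 := hlt.le
  have hle' : α.1 ≤ γ.1 ∧ α.2 ≤ γ.2 := hαγ
  have hN := remaining_semigroupType h
  -- By locality a nonzero `μ` raises both coordinates, so `γ + μ` lies above `β` and `x` translates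
  -- it into `S`.
  have hPF : ∀ x ∈ translators S β \ translators S α, x + γ ∈ pseudoFrobenius S := by
    rintro x ⟨hx, hxα⟩
    refine ⟨fun hmem => hxα (htest x hx hmem), fun μ hμ hμ0 => ?_⟩
    rw [add_assoc]
    have h1 : μ.1 ≠ 0 := fun h0 => hμ0 (hloc μ hμ (Or.inl h0))
    have h2 : μ.2 ≠ 0 := fun h0 => hμ0 (hloc μ hμ (Or.inr h0))
    refine hx _ (S.add_mem hγ hμ) (le_of_lt_min h.min_mem hβ hlt.le hcov (S.add_mem hγ hμ) ?_ ?_)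
    · exact hαγ.trans le_self_add
    · simp only [Prod.fst_add, Prod.snd_add]
      omega
  refine pathHits_le_add (lev := fun x => levelIndex (pseudoFrobenius S) (x + γ))
    (h.minClosed_translators β) ⟨fun x hx => ?_, fun x hx y hy hxy => ?_,
      fun x hx u hu v hv he h1 h2 => ?_⟩ n p _ fun x hx _ => ?_
  · obtain ⟨i, hi, -⟩ := exists_levelIndex_eq hN (hPF x hx)
    omega
  · exact levelIndex_lt_of_strictlyBelow hN (hPF x hx)
      ⟨Nat.add_lt_add_right hxy.1 _, Nat.add_lt_add_right hxy.2 _⟩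
  · have he' := Prod.ext_iff.1 he
    simp only at he'
    refine min_levelIndex_lt hN (hPF x hx) ?_ ?_ ?_
    · rw [ne_eq, add_left_inj, Prod.ext_iff]
      omega
    · rw [ne_eq, add_left_inj, Prod.ext_iff]
      omega
    · simp only [Prod.ext_iff, Prod.fst_add, Prod.snd_add]
      omega
  · exact levelIndex_le (by rw [hN]; exact Set.notMem_empty _)

theorem pathHits_translators_le_of_chain {S : AddSubmonoid (ℕ × ℕ)} (h : IsGood S)
    (hloc : IsLocal S) {α β : ℕ × ℕ} {l : ℕ} (hch : HasSaturatedChain S α β l)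
    (n : ℕ) (p : ℕ × ℕ) :
    pathHits (translators S β) n p ≤ pathHits (translators S α) n p + semigroupType S * l := by
  induction l generalizing α with
  | zero =>
    obtain ⟨a, rfl, rfl, -⟩ := hch
    simp
  | succ l ih =>
    obtain ⟨hα, γ, hlt, hcov, hγ⟩ := hasSaturatedChain_succ.1 hch
    have h1 := ih hγ
    have h2 := pathHits_translators_le h hloc hα hγ.left_mem hlt hcov n p
    rw [mul_add, mul_one]
    omega

theorem translators_zero (S : AddSubmonoid (ℕ × ℕ)) : translators S 0 = S :=
  Set.Subset.antisymm (fun x hx => by simpa using hx 0 S.zero_mem le_rfl)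
    fun _ hx s hs _ => S.add_mem hx hs

theorem IsGood.translators_conductor {S : AddSubmonoid (ℕ × ℕ)} (h : IsGood S) :
    translators S (conductor (S : Set (ℕ × ℕ))) = Set.univ :=
  Set.eq_univ_of_forall fun _ _ _ hs => h.mem_of_conductor_le (hs.trans le_add_self)

/-! ### Genus and length in terms of chains from 0 to the conductor -/

theorem minElement_eq {E : Set (ℕ × ℕ)} {α : ℕ × ℕ} (hα : α ∈ E) (h : ∀ β ∈ E, α ≤ β) :
    minElement E = α := by
  refine Prod.ext (IsLeast.csInf_eq ⟨⟨α, hα, rfl⟩, ?_⟩) (IsLeast.csInf_eq ⟨⟨α, hα, rfl⟩, ?_⟩)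
  · rintro _ ⟨β, hβ, rfl⟩
    exact (h β hβ).1
  · rintro _ ⟨β, hβ, rfl⟩
    exact (h β hβ).2

theorem genus_eq {S : AddSubmonoid (ℕ × ℕ)} :
    genus S = (chainDist Set.univ 0 (conductor (S : Set (ℕ × ℕ))) : ℤ) -
      chainDist S 0 (conductor (S : Set (ℕ × ℕ))) := by
  rw [genus, setDist, minElement_eq (Set.mem_univ 0) fun β _ => zero_le,
    minElement_eq (E := S) S.zero_mem fun β _ => zero_le]

theorem IsGood.length_eq {S : AddSubmonoid (ℕ × ℕ)} (h : IsGood S) :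
    length S = (chainDist S 0 (conductor (S : Set (ℕ × ℕ))) : ℤ) := by
  set c := conductor (S : Set (ℕ × ℕ)) with hc
  have hC : conductorIdeal (S : Set (ℕ × ℕ)) = Set.Ici c :=
    Set.Subset.antisymm (fun _ hx => hx.2) fun _ hx => ⟨h.mem_of_conductor_le hx, hx⟩
  have hcond : conductor (Set.Ici c) = c :=
    minElement_eq (fun x => (le_self_add : c ≤ c + x)) fun β hβ => by simpa using hβ 0
  have hzero : chainDist (Set.Ici c) c c = 0 :=
    Nat.le_zero.1 (Nat.sInf_le (hasSaturatedChain_zero Set.self_mem_Ici))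
  rw [length, setDist, hC, hcond,
    minElement_eq (E := Set.Ici c) (α := c) Set.self_mem_Ici fun _ hβ => hβ,
    minElement_eq (E := S) S.zero_mem fun β _ => zero_le, hzero]
  simp

end GoodSemigroup

theorem proposition3 (S : AddSubmonoid (ℕ × ℕ)) (hgood : GoodSemigroup.IsGood S)
    (hlocal : GoodSemigroup.IsLocal S) :
    GoodSemigroup.genus S ≤ (GoodSemigroup.semigroupType S : ℤ) * GoodSemigroup.length S := by
  open GoodSemigroup in
  rw [genus_eq, hgood.length_eq]
  set c := conductor (S : Set (ℕ × ℕ)) with hc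
  have hch := hasSaturatedChain_chainDist (E := S) S.zero_mem
    (hgood.mem_of_conductor_le le_rfl) zero_le
  have h1 := pathHits_translators_le_of_chain hgood hlocal hch (c.1 + c.2) 0
  rw [hgood.translators_conductor, translators_zero, pathHits_univ] at h1
  have h2 := hch.pathHits_le hgood.min_mem
  simp only [Prod.fst_zero, Prod.snd_zero, Nat.sub_zero] at h2
  have h3 := chainDist_le (Set.mem_univ 0) (Set.mem_univ c) zero_le
  simp only [Prod.fst_zero, Prod.snd_zero, add_zero, Nat.sub_zero] at h3
  zify at h1 h2 h3
  linarith
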